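/- **Setting.** A finite stochastic partial monitoring game is given by a loss matrix $L\in\mathbb{R}^{N\times M}$ with rows $L_i$ and a feedback matrix $H=(h_{i,j})\in[A]^{N\times M}$. Let $\mathcal{P}_M$ be the set of probability vectors over the $M$ outcomes. In each round $t=1,2,\dots$ the learner selects an action $i(t)\in[N]$ (possibly at random) from the actions and signals of the earlier rounds, an outcome $j(t)$ is drawn independently from an unknown $p\in\mathcal{P}_M$, and the learner observes only the signal $h_{i(t),j(t)}$. The regret against $p$ is $\mathrm{Regret}(T)=\sum_{t=1}^{T}\bigl(L_{i(t)}^\top p-\min_{j}L_j^\top p\bigr)$. An algorithm is strongly consistent if, for every $p\in\mathcal{P}_M$ and every $a>0$, its expected regret against $p$ satisfies $\mathbb{E}[\mathrm{Regret}(T)]=o(T^a)$. The signal matrix $S_i\in\{0,1\}^{A\times M}$ has entries $(S_i)_{k,j}=\mathbf 1[h_{i,j}=k]$; the game is globally observable if $L_i-L_j\in\sum_{k}\mathrm{Im}\,S_k^\top$ for all $i,j$. Let $\mathcal{C}_1=\{q\in\mathcal{P}_M:(L_1-L_j)^\top q\le 0\ \text{for all } j\ne1\}$ and $\mathcal{C}_1^c=\mathcal{P}_M\setminus\mathcal{C}_1$,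 let $\mathrm{cl}$ denote the closure, and let $D(x\Vert y)=\sum_k x_k\log(x_k/y_k)\in[0,\infty]$ be the Kullback–Leibler divergence (with $0\log\frac{0}{0}=0$). **Theorem.** Let the game be globally observable, let $p^*\in\mathcal{P}_M$ be such that action $1$ is the unique optimal action, i.e. $L_1^\top p^*<L_i^\top p^*$ for all $i\neq 1$, put $p_i^*=S_ip^*$ and $\mathcal{S}_0=\{q:S_1q=p_1^*\}$, and assume the regularity condition $$\mathrm{cl}(\mathcal{C}_1^c)\cap\mathcal{S}_0\subseteq\mathrm{cl}\bigl(\mathcal{C}_1^c\cap\mathcal{S}_0\bigr).$$ Let $$C_1^*(p^*,\{p_i^*\})=\inf\Bigl\{\sum_{i\ne1}r_i(L_i-L_1)^\top p^*\;:\;r_i\ge0,\ \inf_{q\in\mathrm{cl}(\mathcal{C}_1^c)\cap\mathcal{S}_0}\ \sum_{i\neq1}r_iD(p_i^*\Vert S_iq)\ge1\Bigr\},$$ where an infimum over the empty set of $q$ is $+\infty$. Then the set of feasible $(r_i)_{i\ne1}$ is non-empty, so that $C_1^*(p^*,\{p_i^*\})$ is finite, and every strongly consistent algorithm satisfies, against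 $p^*$, $$\mathbb{E}[\mathrm{Regret}(T)]\ge C_1^*(p^*,\{p_i^*\})\log T-o(\log T)\qquad(T\to\infty).$$ -/

import Mathlib

open Filter Asymptotics
open scoped ENNReal Matrix

noncomputable section

namespace PartialMonitoring

/-- A (possibly randomized) algorithm for a game with `N` actions and `A` signals. At round `t`
(rounds are numbered from `0`) it sees the actions and the signals of the earlier rounds and
draws its next action from the distribution `prob t history`. -/
structure Algorithm (N A : ℕ) where
  prob : (t : ℕ) → (Fin t → Fin N × Fin A) → Fin N → ℝ
  prob_mem : ∀ t history, prob t history ∈ stdSimplex ℝ (Fin N)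

variable {N M A : ℕ}

/-- What the learner has observed before round `t`, when `ω` lists the actions and the outcomes of
the rounds: the actions and the signals. -/
def observed (H : Matrix (Fin N) (Fin M) (Fin A)) {T : ℕ} (ω : Fin T → Fin N × Fin M)
    (t : Fin T) : Fin t → Fin N × Fin A :=
  fun s =>
    let x := ω (Fin.castLE t.isLt.le s)
    (x.1, H x.1 x.2)

/-- The probability that the first `T` rounds have the actions and outcomes listed by `ω`: in each
round the action is drawn by the algorithm from what it has observed, and the outcome is drawn
from the opponent's strategy `p`, independently of the past and of the action. -/
def pathProb (H : Matrix (Fin N) (Fin M) (Fin A)) (π : Algorithm N A) (p : Fin M → ℝ) {T : ℕ}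
    (ω : Fin T → Fin N × Fin M) : ℝ :=
  ∏ t : Fin T, π.prob t (observed H ω t) (ω t).1 * p (ω t).2

/-- The expected loss of action `i` under `p` minus the smallest expected loss of an action. -/
def gap (L : Matrix (Fin N) (Fin M) ℝ) (p : Fin M → ℝ) (i : Fin N) : ℝ :=
  L i ⬝ᵥ p - ⨅ j, L j ⬝ᵥ p

/-- The expected (pseudo) regret after `T` rounds. -/
def expectedRegret (L : Matrix (Fin N) (Fin M) ℝ) (H : Matrix (Fin N) (Fin M) (Fin A))
    (π : Algorithm N A) (p : Fin M → ℝ) (T : ℕ) : ℝ :=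
  ∑ ω : Fin T → Fin N × Fin M, pathProb H π p ω * ∑ t, gap L p (ω t).1

/-- Strong consistency: for each strategy of the opponent and each `a > 0`, the expected regret
is `o(T ^ a)`. -/
def StronglyConsistent (L : Matrix (Fin N) (Fin M) ℝ) (H : Matrix (Fin N) (Fin M) (Fin A))
    (π : Algorithm N A) : Prop :=
  ∀ p ∈ stdSimplex ℝ (Fin M), ∀ a : ℝ, 0 < a →
    (fun T : ℕ => expectedRegret L H π p T) =o[atTop] (fun T : ℕ => (T : ℝ) ^ a)

/-- The signal matrix of action `i`. -/
def signalMatrix (H : Matrix (Fin N) (Fin M) (Fin A)) (i : Fin N) : Matrix (Fin A) (Fin M) ℝ :=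
  Matrix.of fun k j => if H i j = k then 1 else 0

/-- Global observability: each `L i - L j` lies in the sum of the images of the transposed signal
matrices. -/
def GloballyObservable (L : Matrix (Fin N) (Fin M) ℝ) (H : Matrix (Fin N) (Fin M) (Fin A)) :
    Prop :=
  ∀ i j, L i - L j ∈ ⨆ k, LinearMap.range (signalMatrix H k)ᵀ.mulVecLin

/-- The optimality cell of action `i`. -/
def cell (L : Matrix (Fin N) (Fin M) ℝ) (i : Fin N) : Set (Fin M → ℝ) :=
  {q ∈ stdSimplex ℝ (Fin M) | ∀ j, j ≠ i → (L i - L j) ⬝ᵥ q ≤ 0}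

/-- The strategies for which action `i` is not optimal. -/
def cellCompl (L : Matrix (Fin N) (Fin M) ℝ) (i : Fin N) : Set (Fin M → ℝ) :=
  stdSimplex ℝ (Fin M) \ cell L i

open Classical in
/-- The Kullback-Leibler divergence of two probability vectors, with value `∞` if some `x k > 0`
while `y k = 0`. The real sum is non-negative for probability vectors; its terms with `x k = 0`
vanish. -/
def klDivergence (x y : Fin A → ℝ) : ℝ≥0∞ :=
  if ∀ k, y k = 0 → x k = 0 then ENNReal.ofReal (∑ k, x k * Real.log (x k / y k)) else ∞

/-- The strategies under which action `i` has signal distribution `x`. -/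
def signalFiber (H : Matrix (Fin N) (Fin M) (Fin A)) (i : Fin N) (x : Fin A → ℝ) :
    Set (Fin M → ℝ) :=
  {q | x = signalMatrix H i *ᵥ q}

/-- The feasible set of the linear semi-infinite program, for signal distributions `P i`. The
infimum is taken in `[0, ∞]`, so it is `∞` if there is no such `q`. -/
def admissible (L : Matrix (Fin N) (Fin M) ℝ) (H : Matrix (Fin N) (Fin M) (Fin A)) (j : Fin N)
    (P : Fin N → Fin A → ℝ) : Set ({i : Fin N // i ≠ j} → ℝ) :=
  {r | (∀ i, 0 ≤ r i) ∧
    1 ≤ ⨅ q ∈ closure (cellCompl L j) ∩ signalFiber H j (P j),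
      ∑ i, ENNReal.ofReal (r i) * klDivergence (P i) (signalMatrix H i *ᵥ q)}

/-- The value of the linear semi-infinite program. -/
def lsipValue (L : Matrix (Fin N) (Fin M) ℝ) (H : Matrix (Fin N) (Fin M) (Fin A)) (j : Fin N)
    (p : Fin M → ℝ) (P : Fin N → Fin A → ℝ) : ℝ :=
  sInf ((fun r => ∑ i : {i : Fin N // i ≠ j}, r i * ((L i - L j) ⬝ᵥ p)) '' admissible L H j P)

end PartialMonitoring

end

/-!
The lower bound is an information-theoretic one. Let `q` be an alternative under which action `i₁`
is not optimal although it has the same signal distribution as under `p`. A consistent algorithm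
plays `i₁` in almost all rounds under `p`, but only `o(T ^ a)` times under `q`, so its observations
have to tell `p` from `q`. What it learns is measured by the expected log-likelihood ratio of the
history, which is the sum over the actions `i` of the expected number of plays of `i` times the
divergence of the signal distributions of `i` under `p` and `q` (`sum_historyProb_mul_sum`).
The Donsker-Varadhan inequality, applied to the fraction of rounds in which `i₁` is played
(`mul_expectedPlays_le`), shows that this sum is at least `(1 - o(1)) * log T`.

Hence a limit point `r` of the expected numbers of plays divided by `log T` satisfies the constraint
of the program for each such `q` with finite divergences (`one_le_sum_mul_realKL`). The regularity
condition and the continuity of the divergence where it is finite extend this to the closure. For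
a `q` with an infinite divergence the constraint may fail at `r`, when the action that has this
divergence is played only `o(log T)` times, but it holds for `r + ε` (`add_mem_admissible`). Since
the value of `r + ε` tends to that of `r`, the regret cannot be smaller than the value of the program
times `log T` by a multiple of `log T` infinitely often (`eventually_lsipValue_mul_log_le`).

The program is feasible because, by global observability, no `q` in the compact set of alternatives
agrees with `p` on the signal distributions of all actions, and the divergence dominates the squared
Hellinger distance, which is continuous and therefore bounded below there (`admissible_nonempty`).
-/

namespace PartialMonitoring

variable {N M A : ℕ}

/-! ### The law of the history -/

lemma signalMatrix_mulVec_apply (H : Matrix (Fin N) (Fin M) (Fin A)) (i : Fin N) (p : Fin M → ℝ)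
    (k : Fin A) : (signalMatrix H i *ᵥ p) k = ∑ j, if H i j = k then p j else 0 := by
  simp [Matrix.mulVec, dotProduct, signalMatrix]

lemma signalMatrix_mulVec_mem (H : Matrix (Fin N) (Fin M) (Fin A)) (i : Fin N) {p : Fin M → ℝ}
    (hp : p ∈ stdSimplex ℝ (Fin M)) : signalMatrix H i *ᵥ p ∈ stdSimplex ℝ (Fin A) := by
  refine ⟨fun k => ?_, ?_⟩
  · rw [signalMatrix_mulVec_apply]
    exact Finset.sum_nonneg fun j _ => by split_ifs <;> simp [hp.1 j]
  · simp_rw [signalMatrix_mulVec_apply]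
    rw [Finset.sum_comm]
    simpa using hp.2

/-- The probability that the actions and the signals of the first `T` rounds are those listed by
`η`. -/
noncomputable def historyProb (H : Matrix (Fin N) (Fin M) (Fin A)) (π : Algorithm N A)
    (p : Fin M → ℝ) {T : ℕ} (η : Fin T → Fin N × Fin A) : ℝ :=
  ∏ t : Fin T, π.prob t (fun s => η (Fin.castLE t.isLt.le s)) (η t).1 *
    (signalMatrix H (η t).1 *ᵥ p) (η t).2

/-- The law of the history is the image of the law of the actions and outcomes: the paths that
produce a given history form a product set, over which the product of the round probabilities
factorizes. -/
lemma sum_pathProb_mul (H : Matrix (Fin N) (Fin M) (Fin A)) (π : Algorithm N A) (p : Fin M → ℝ)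
    {T : ℕ} (F : (Fin T → Fin N × Fin A) → ℝ) :
    ∑ ω : Fin T → Fin N × Fin M, pathProb H π p ω * F (fun t => ((ω t).1, H (ω t).1 (ω t).2)) =
      ∑ η, historyProb H π p η * F η := by
  classical
  rw [← Finset.sum_fiberwise (s := Finset.univ)
    (g := fun (ω : Fin T → Fin N × Fin M) t => ((ω t).1, H (ω t).1 (ω t).2))]
  refine Finset.sum_congr rfl fun η _ => ?_
  have hset : (Finset.univ.filter fun ω : Fin T → Fin N × Fin M =>
      (fun t => ((ω t).1, H (ω t).1 (ω t).2)) = η) =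
      Fintype.piFinset fun t => Finset.univ.filter fun x : Fin N × Fin M =>
        (x.1, H x.1 x.2) = η t := by
    ext ω
    simp [funext_iff]
  have hround : ∀ t, (signalMatrix H (η t).1 *ᵥ p) (η t).2 =
      ∑ x ∈ Finset.univ.filter (fun x : Fin N × Fin M => (x.1, H x.1 x.2) = η t), p x.2 := by
    intro t
    rw [signalMatrix_mulVec_apply, Finset.sum_filter, Fintype.sum_prod_type,
      Finset.sum_eq_single (η t).1]
    · refine Finset.sum_congr rfl fun j _ => ?_
      simp [Prod.ext_iff]
    · intro i _ hi
      refine Finset.sum_eq_zero fun j _ => ?_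
      simp [Prod.ext_iff, hi]
    · simp
  have hpath : ∀ ω ∈ Finset.univ.filter (fun ω : Fin T → Fin N × Fin M =>
      (fun t => ((ω t).1, H (ω t).1 (ω t).2)) = η),
      pathProb H π p ω * F (fun t => ((ω t).1, H (ω t).1 (ω t).2)) =
        ((∏ t : Fin T, π.prob t (fun s => η (Fin.castLE t.isLt.le s)) (η t).1) * F η) *
          ∏ t, p (ω t).2 := by
    intro ω hω
    have h : (fun t => ((ω t).1, H (ω t).1 (ω t).2)) = η := (Finset.mem_filter.mp hω).2
    subst h
    have hprod : pathProb H π p ω =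
        (∏ t : Fin T, π.prob t (observed H ω t) (ω t).1) * ∏ t, p (ω t).2 :=
      Finset.prod_mul_distrib
    rw [hprod, mul_right_comm]
    rfl
  have hfactor : ∑ ω ∈ Fintype.piFinset fun t => Finset.univ.filter fun x : Fin N × Fin M =>
      (x.1, H x.1 x.2) = η t, ∏ t, p (ω t).2 =
      ∏ t, (signalMatrix H (η t).1 *ᵥ p) (η t).2 := by
    rw [Finset.prod_congr rfl fun t _ => hround t]
    exact (Finset.prod_univ_sum _ fun _ (x : Fin N × Fin M) => p x.2).symm
  rw [Finset.sum_congr rfl hpath, ← Finset.mul_sum, hset, hfactor, historyProb,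
    Finset.prod_mul_distrib]
  ring

lemma historyProb_nonneg (H : Matrix (Fin N) (Fin M) (Fin A)) (π : Algorithm N A) {p : Fin M → ℝ}
    (hp : p ∈ stdSimplex ℝ (Fin M)) {T : ℕ} (η : Fin T → Fin N × Fin A) :
    0 ≤ historyProb H π p η :=
  Finset.prod_nonneg fun _ _ =>
    mul_nonneg ((π.prob_mem _ _).1 _) ((signalMatrix_mulVec_mem H _ hp).1 _)

lemma historyProb_snoc (H : Matrix (Fin N) (Fin M) (Fin A)) (π : Algorithm N A) (p : Fin M → ℝ)
    {T : ℕ} (η : Fin T → Fin N × Fin A) (x : Fin N × Fin A) :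
    historyProb H π p (Fin.snoc η x : Fin (T + 1) → Fin N × Fin A) =
      historyProb H π p η * (π.prob T η x.1 * (signalMatrix H x.1 *ᵥ p) x.2) := by
  have h : ∀ (t : Fin T) (s : Fin t), (Fin.snoc η x : Fin (T + 1) → Fin N × Fin A)
      (Fin.castLE t.castSucc.isLt.le s) = η (Fin.castLE t.isLt.le s) := fun t s =>
    Fin.snoc_castSucc (α := fun _ => Fin N × Fin A) x η (Fin.castLE t.isLt.le s)
  have h' : ∀ s : Fin T, (Fin.snoc η x : Fin (T + 1) → Fin N × Fin A)
      (Fin.castLE (Fin.last T).isLt.le s) = η s := fun s =>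
    Fin.snoc_castSucc (α := fun _ => Fin N × Fin A) x η s
  rw [historyProb, Fin.prod_univ_castSucc]
  simp only [Fin.snoc_castSucc, Fin.snoc_last]
  congr 1
  · refine Finset.prod_congr rfl fun t _ => ?_
    congr 2
    exact funext (h t)
  · congr 2
    exact funext h'

lemma sum_historyProb_succ (H : Matrix (Fin N) (Fin M) (Fin A)) (π : Algorithm N A)
    (p : Fin M → ℝ) {T : ℕ} (F : (Fin (T + 1) → Fin N × Fin A) → ℝ) :
    ∑ η, historyProb H π p η * F η =
      ∑ η : Fin T → Fin N × Fin A, historyProb H π p η *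
        ∑ i, π.prob T η i * ∑ k, (signalMatrix H i *ᵥ p) k * F (Fin.snoc η (i, k)) := by
  rw [← (Fin.snocEquiv fun _ : Fin (T + 1) => Fin N × Fin A).sum_comp, Fintype.sum_prod_type,
    Finset.sum_comm]
  refine Finset.sum_congr rfl fun η _ => ?_
  rw [Fintype.sum_prod_type, Finset.mul_sum]
  refine Finset.sum_congr rfl fun i _ => ?_
  rw [Finset.mul_sum, Finset.mul_sum]
  refine Finset.sum_congr rfl fun k _ => ?_
  have := historyProb_snoc H π p η (i, k)
  simp only [Fin.snocEquiv, Equiv.coe_fn_mk]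
  rw [this]
  ring

lemma sum_historyProb (H : Matrix (Fin N) (Fin M) (Fin A)) (π : Algorithm N A) {p : Fin M → ℝ}
    (hp : p ∈ stdSimplex ℝ (Fin M)) (T : ℕ) :
    ∑ η : Fin T → Fin N × Fin A, historyProb H π p η = 1 := by
  induction T with
  | zero => simp [historyProb]
  | succ T ih =>
    have h := sum_historyProb_succ H π p (T := T) fun _ => 1
    simp only [mul_one] at h
    rw [h, ← ih]
    refine Finset.sum_congr rfl fun η _ => ?_
    simp [(signalMatrix_mulVec_mem H _ hp).2, (π.prob_mem T η).2]

/-! ### Expected numbers of plays and the regret -/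

/-- The expected number of the first `T` rounds in which action `i` is played. -/
noncomputable def expectedPlays (H : Matrix (Fin N) (Fin M) (Fin A)) (π : Algorithm N A)
    (p : Fin M → ℝ) (T : ℕ) (i : Fin N) : ℝ :=
  ∑ η : Fin T → Fin N × Fin A, historyProb H π p η * ∑ t, if (η t).1 = i then 1 else 0

/-- Wald's identity: given the action of a round, its signal is independent of the past. -/
lemma sum_historyProb_mul_sum (H : Matrix (Fin N) (Fin M) (Fin A)) (π : Algorithm N A)
    {p : Fin M → ℝ} (hp : p ∈ stdSimplex ℝ (Fin M)) (T : ℕ) (φ : Fin N → Fin A → ℝ) :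
    ∑ η : Fin T → Fin N × Fin A, historyProb H π p η * ∑ t, φ (η t).1 (η t).2 =
      ∑ i, expectedPlays H π p T i * ∑ k, (signalMatrix H i *ᵥ p) k * φ i k := by
  have step : ∀ (T : ℕ) (φ : Fin N → Fin A → ℝ),
      ∑ η : Fin (T + 1) → Fin N × Fin A, historyProb H π p η * ∑ t, φ (η t).1 (η t).2 =
      ∑ η : Fin T → Fin N × Fin A, historyProb H π p η * ∑ t, φ (η t).1 (η t).2 +
      ∑ η : Fin T → Fin N × Fin A, historyProb H π p η *
        ∑ i, π.prob T η i * ∑ k, (signalMatrix H i *ᵥ p) k * φ i k := by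
    intro T φ
    rw [sum_historyProb_succ, ← Finset.sum_add_distrib]
    refine Finset.sum_congr rfl fun η _ => ?_
    simp only [Fin.sum_univ_castSucc, Fin.snoc_castSucc, Fin.snoc_last, mul_add,
      Finset.sum_add_distrib]
    simp only [← Finset.sum_mul, (signalMatrix_mulVec_mem H _ hp).2, (π.prob_mem T η).2, one_mul]
  induction T with
  | zero => simp [expectedPlays]
  | succ T ih =>
    have hplays : ∀ i, expectedPlays H π p (T + 1) i = expectedPlays H π p T i +
        ∑ η : Fin T → Fin N × Fin A, historyProb H π p η * π.prob T η i := by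
      intro i
      rw [expectedPlays, step T fun a _ => if a = i then 1 else 0, expectedPlays]
      congr 1
      refine Finset.sum_congr rfl fun η _ => ?_
      simp only [← Finset.sum_mul, (signalMatrix_mulVec_mem H _ hp).2]
      simp
    rw [step, ih]
    simp only [hplays, add_mul, Finset.sum_add_distrib]
    congr 1
    have hswap : ∀ m : Fin N → ℝ,
        ∑ η : Fin T → Fin N × Fin A, historyProb H π p η * ∑ i, π.prob T η i * m i =
          ∑ i, (∑ η : Fin T → Fin N × Fin A, historyProb H π p η * π.prob T η i) * m i := by
      intro m
      simp only [Finset.sum_mul, Finset.mul_sum, ← mul_assoc]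
      exact Finset.sum_comm
    exact hswap _

lemma expectedPlays_nonneg (H : Matrix (Fin N) (Fin M) (Fin A)) (π : Algorithm N A)
    {p : Fin M → ℝ} (hp : p ∈ stdSimplex ℝ (Fin M)) (T : ℕ) (i : Fin N) :
    0 ≤ expectedPlays H π p T i :=
  Finset.sum_nonneg fun η _ => mul_nonneg (historyProb_nonneg H π hp η)
    (Finset.sum_nonneg fun _ _ => by split_ifs <;> simp)

lemma sum_expectedPlays (H : Matrix (Fin N) (Fin M) (Fin A)) (π : Algorithm N A)
    {p : Fin M → ℝ} (hp : p ∈ stdSimplex ℝ (Fin M)) (T : ℕ) :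
    ∑ i, expectedPlays H π p T i = T := by
  have h := sum_historyProb_mul_sum H π hp T fun _ _ => 1
  simp only [mul_one, (signalMatrix_mulVec_mem H _ hp).2] at h
  rw [← h, ← Finset.sum_mul, sum_historyProb H π hp]
  simp

lemma expectedRegret_eq_sum (L : Matrix (Fin N) (Fin M) ℝ) (H : Matrix (Fin N) (Fin M) (Fin A))
    (π : Algorithm N A) {p : Fin M → ℝ} (hp : p ∈ stdSimplex ℝ (Fin M)) (T : ℕ) :
    expectedRegret L H π p T = ∑ i, expectedPlays H π p T i * gap L p i := by
  have h := sum_historyProb_mul_sum H π hp T fun i _ => gap L p i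
  simp only [← Finset.sum_mul, (signalMatrix_mulVec_mem H _ hp).2, one_mul] at h
  rw [← h, ← sum_pathProb_mul H π p fun η => ∑ t, gap L p (η t).1]
  rfl

lemma gap_nonneg (L : Matrix (Fin N) (Fin M) ℝ) (p : Fin M → ℝ) (i : Fin N) : 0 ≤ gap L p i :=
  sub_nonneg.mpr (ciInf_le (Set.finite_range _).bddBelow i)

lemma gap_eq_of_isOptimal {L : Matrix (Fin N) (Fin M) ℝ} {p : Fin M → ℝ} {i₁ : Fin N}
    (hopt : ∀ i, i ≠ i₁ → L i₁ ⬝ᵥ p < L i ⬝ᵥ p) (i : Fin N) :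
    gap L p i = (L i - L i₁) ⬝ᵥ p := by
  have : ⨅ j, L j ⬝ᵥ p = L i₁ ⬝ᵥ p := by
    have : Nonempty (Fin N) := ⟨i₁⟩
    refine le_antisymm (ciInf_le (Set.finite_range _).bddBelow i₁) (le_ciInf fun j => ?_)
    by_cases h : j = i₁
    · rw [h]
    · exact (hopt j h).le
  rw [gap, this, sub_dotProduct]

lemma gap_pos_of_mem_cellCompl {L : Matrix (Fin N) (Fin M) ℝ} {q : Fin M → ℝ} {i : Fin N}
    (hq : q ∈ cellCompl L i) : 0 < gap L q i := by
  obtain ⟨hq, hcell⟩ := hq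
  have : ∃ j, 0 < (L i - L j) ⬝ᵥ q := by
    by_contra! h
    exact hcell ⟨hq, fun j _ => h j⟩
  obtain ⟨j, hj⟩ := this
  rw [sub_dotProduct, sub_pos] at hj
  exact sub_pos.mpr ((ciInf_le (Set.finite_range _).bddBelow j).trans_lt hj)

/-- A consistent algorithm plays a suboptimal action `o(T ^ a)` times. -/
lemma StronglyConsistent.expectedPlays_isLittleO {L : Matrix (Fin N) (Fin M) ℝ}
    {H : Matrix (Fin N) (Fin M) (Fin A)} {π : Algorithm N A} (hπ : StronglyConsistent L H π)
    {p : Fin M → ℝ} (hp : p ∈ stdSimplex ℝ (Fin M)) {i : Fin N} (hi : 0 < gap L p i) {a : ℝ}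
    (ha : 0 < a) :
    (fun T : ℕ => expectedPlays H π p T i) =o[atTop] fun T : ℕ => (T : ℝ) ^ a := by
  refine IsBigO.trans_isLittleO (IsBigO.of_bound (gap L p i)⁻¹ ?_) (hπ p hp a ha)
  refine Eventually.of_forall fun T => ?_
  have hn := fun j => mul_nonneg (expectedPlays_nonneg H π hp T j) (gap_nonneg L p j)
  have hle : expectedPlays H π p T i * gap L p i ≤ expectedRegret L H π p T := by
    rw [expectedRegret_eq_sum L H π hp]
    exact Finset.single_le_sum (f := fun j => expectedPlays H π p T j * gap L p j)
      (fun j _ => hn j) (Finset.mem_univ i)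
  rw [Real.norm_of_nonneg (expectedPlays_nonneg H π hp T i),
    Real.norm_of_nonneg ((hn i).trans hle), inv_mul_eq_div, le_div_iff₀ hi]
  exact hle

/-! ### The information inequality -/

/-- The divergence as a real number, meaningful when `x` is absolutely continuous with respect
to `y`. -/
noncomputable def realKL (x y : Fin A → ℝ) : ℝ :=
  ∑ k, x k * Real.log (x k / y k)

lemma klDivergence_of_ac {x y : Fin A → ℝ} (h : ∀ k, y k = 0 → x k = 0) :
    klDivergence x y = ENNReal.ofReal (realKL x y) := if_pos h

lemma klDivergence_of_not_ac {x y : Fin A → ℝ} (h : ¬ ∀ k, y k = 0 → x k = 0) :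
    klDivergence x y = ∞ := if_neg h

/-- Change of measure: the law under `p`, reweighted by the exponential of minus the log-likelihood
ratio, is at most the law under `q`. It may be smaller, on histories impossible under `p`. -/
lemma sum_historyProb_mul_exp_le (H : Matrix (Fin N) (Fin M) (Fin A)) (π : Algorithm N A)
    {p q : Fin M → ℝ} (hp : p ∈ stdSimplex ℝ (Fin M)) (hq : q ∈ stdSimplex ℝ (Fin M))
    (hac : ∀ i k, (signalMatrix H i *ᵥ q) k = 0 → (signalMatrix H i *ᵥ p) k = 0) {T : ℕ}
    (η : Fin T → Fin N × Fin A) :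
    historyProb H π p η * Real.exp (-∑ t, Real.log ((signalMatrix H (η t).1 *ᵥ p) (η t).2 /
      (signalMatrix H (η t).1 *ᵥ q) (η t).2)) ≤ historyProb H π q η := by
  rw [← Finset.sum_neg_distrib, Real.exp_sum, historyProb, historyProb, ← Finset.prod_mul_distrib]
  refine Finset.prod_le_prod (fun t _ => ?_) fun t _ => ?_
  · exact mul_nonneg (mul_nonneg ((π.prob_mem _ _).1 _) ((signalMatrix_mulVec_mem H _ hp).1 _))
      (Real.exp_pos _).le
  · rw [mul_assoc]
    refine mul_le_mul_of_nonneg_left ?_ ((π.prob_mem _ _).1 _)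
    have hx := (signalMatrix_mulVec_mem H (η t).1 hp).1 (η t).2
    have hy := (signalMatrix_mulVec_mem H (η t).1 hq).1 (η t).2
    have h := hac (η t).1 (η t).2
    generalize (signalMatrix H (η t).1 *ᵥ p) (η t).2 = x at *
    generalize (signalMatrix H (η t).1 *ᵥ q) (η t).2 = y at *
    rcases hx.eq_or_lt with rfl | hx
    · simpa using hy
    · have hy' : 0 < y := hy.lt_of_ne fun h0 => hx.ne' (h h0.symm)
      rw [Real.exp_neg, Real.exp_log (div_pos hx hy')]
      field_simp
      exact le_rfl

/-- The information inequality: to tell `p` from `q`, that is, to play action `i₁` in most rounds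
under `p` but seldom under `q`, the algorithm has to gather enough divergence. It is the
Donsker-Varadhan inequality for the functional `c * (number of plays of i₁) / T`. -/
lemma mul_expectedPlays_le (H : Matrix (Fin N) (Fin M) (Fin A)) (π : Algorithm N A)
    {p q : Fin M → ℝ} (hp : p ∈ stdSimplex ℝ (Fin M)) (hq : q ∈ stdSimplex ℝ (Fin M))
    (hac : ∀ i k, (signalMatrix H i *ᵥ q) k = 0 → (signalMatrix H i *ᵥ p) k = 0)
    (i₁ : Fin N) {T : ℕ} (hT : 0 < T) {c : ℝ}
    (hc : Real.exp c * (expectedPlays H π q T i₁ / T) ≤ 1) :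
    c * (expectedPlays H π p T i₁ / T) ≤ Real.log 2 +
      ∑ i, expectedPlays H π p T i * realKL (signalMatrix H i *ᵥ p) (signalMatrix H i *ᵥ q) := by
  have hT' : (0 : ℝ) < T := by exact_mod_cast hT
  let Z : (Fin T → Fin N × Fin A) → ℝ := fun η => ∑ t,
    Real.log ((signalMatrix H (η t).1 *ᵥ p) (η t).2 / (signalMatrix H (η t).1 *ᵥ q) (η t).2)
  let n : (Fin T → Fin N × Fin A) → ℝ := fun η => ∑ t, if (η t).1 = i₁ then 1 else 0
  have hZ : ∑ η, historyProb H π p η * Z η =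
      ∑ i, expectedPlays H π p T i * realKL (signalMatrix H i *ᵥ p) (signalMatrix H i *ᵥ q) :=
    sum_historyProb_mul_sum H π hp T fun i k =>
      Real.log ((signalMatrix H i *ᵥ p) k / (signalMatrix H i *ᵥ q) k)
  have hn0 : ∀ η, 0 ≤ n η / T := fun η =>
    div_nonneg (Finset.sum_nonneg fun t _ => by split_ifs <;> simp) hT'.le
  have hn1 : ∀ η, n η / T ≤ 1 := fun η => by
    rw [div_le_one hT']
    calc n η ≤ ∑ _t : Fin T, (1 : ℝ) := Finset.sum_le_sum fun t _ => by split_ifs <;> simp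
      _ = T := by simp
  -- Convexity of `exp` on `[0, c]`.
  have hexp : ∀ η, Real.exp (c * (n η / T)) ≤ 1 + n η / T * Real.exp c := by
    intro η
    have := convexOn_exp.2 (Set.mem_univ 0) (Set.mem_univ c) (sub_nonneg.mpr (hn1 η)) (hn0 η)
      (by ring)
    simp only [smul_eq_mul, mul_zero, zero_add, Real.exp_zero, mul_one] at this
    rw [mul_comm c]
    linarith [hn0 η]
  have hq2 : ∑ η, historyProb H π q η * Real.exp (c * (n η / T)) ≤ 2 := by
    calc _ ≤ ∑ η, historyProb H π q η * (1 + n η / T * Real.exp c) :=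
          Finset.sum_le_sum fun η _ =>
            mul_le_mul_of_nonneg_left (hexp η) (historyProb_nonneg H π hq η)
      _ = ∑ η, historyProb H π q η +
            Real.exp c * ((∑ η, historyProb H π q η * n η) / T) := by
          rw [Finset.sum_div, Finset.mul_sum, ← Finset.sum_add_distrib]
          exact Finset.sum_congr rfl fun η _ => by ring
      _ ≤ 2 := by
          rw [sum_historyProb H π hq]
          have : Real.exp c * ((∑ η, historyProb H π q η * n η) / T) ≤ 1 := hc
          linarith
  -- `1 + x ≤ exp x` at `x = c * (n η / T) - Z η - log 2`; the `log 2` absorbs the bound `hq2`.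
  have key : ∑ η, historyProb H π p η * (c * (n η / T) - Z η - Real.log 2 + 1) ≤ 1 := by
    calc _ ≤ ∑ η, historyProb H π q η * Real.exp (c * (n η / T)) / 2 := by
          refine Finset.sum_le_sum fun η _ => ?_
          calc _ ≤ historyProb H π p η * Real.exp (c * (n η / T) - Z η - Real.log 2) :=
                mul_le_mul_of_nonneg_left (Real.add_one_le_exp _) (historyProb_nonneg H π hp η)
            _ = (historyProb H π p η * Real.exp (-Z η)) * Real.exp (c * (n η / T)) / 2 := by
                rw [Real.exp_sub, Real.exp_log two_pos, sub_eq_neg_add, Real.exp_add]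
                ring
            _ ≤ _ := by
                gcongr
                exact sum_historyProb_mul_exp_le H π hp hq hac η
      _ ≤ 1 := by
          rw [← Finset.sum_div]
          linarith
  have hsplit : ∑ η, historyProb H π p η * (c * (n η / T) - Z η - Real.log 2 + 1) =
      c * ((∑ η, historyProb H π p η * n η) / T) - ∑ η, historyProb H π p η * Z η +
        (1 - Real.log 2) * ∑ η : Fin T → Fin N × Fin A, historyProb H π p η := by
    rw [Finset.sum_div, Finset.mul_sum, Finset.mul_sum, ← Finset.sum_sub_distrib,
      ← Finset.sum_add_distrib]
    exact Finset.sum_congr rfl fun η _ => by ring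
  rw [hsplit, hZ, sum_historyProb H π hp] at key
  have : c * (expectedPlays H π p T i₁ / T) = c * ((∑ η, historyProb H π p η * n η) / T) := rfl
  linarith

lemma realKL_self (x : Fin A → ℝ) : realKL x x = 0 := by
  refine Finset.sum_eq_zero fun k _ => ?_
  by_cases h : x k = 0 <;> simp [h]

/-! ### Limit points of the numbers of plays -/

/-- The logarithmic lower bound for a single alternative `q` that action `i₁` cannot tell
from `p`. -/
lemma one_le_sum_mul_realKL {L : Matrix (Fin N) (Fin M) ℝ} {H : Matrix (Fin N) (Fin M) (Fin A)}
    {π : Algorithm N A} (hπ : StronglyConsistent L H π) {p : Fin M → ℝ}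
    (hp : p ∈ stdSimplex ℝ (Fin M)) {i₁ : Fin N} (hgap : ∀ i, i ≠ i₁ → 0 < gap L p i)
    {l : Filter ℕ} [NeBot l] (hl : l ≤ atTop) {r : {i : Fin N // i ≠ i₁} → ℝ}
    (hr : ∀ i : {i : Fin N // i ≠ i₁},
      Tendsto (fun T : ℕ => expectedPlays H π p T i / Real.log T) l (nhds (r i)))
    {q : Fin M → ℝ} (hq : q ∈ cellCompl L i₁)
    (hfib : signalMatrix H i₁ *ᵥ p = signalMatrix H i₁ *ᵥ q)
    (hac : ∀ i k, (signalMatrix H i *ᵥ q) k = 0 → (signalMatrix H i *ᵥ p) k = 0) :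
    1 ≤ ∑ i, r i * realKL (signalMatrix H i *ᵥ p) (signalMatrix H i *ᵥ q) := by
  refine le_of_forall_pos_le_add fun a ha => ?_
  have hpos : ∀ᶠ T : ℕ in atTop, (1 : ℝ) < T :=
    tendsto_natCast_atTop_atTop.eventually_gt_atTop 1
  have hlog : Tendsto (fun T : ℕ => Real.log T) atTop atTop :=
    Real.tendsto_log_atTop.comp tendsto_natCast_atTop_atTop
  -- Under `q` action `i₁` is suboptimal, hence rarely played.
  have hqplays : ∀ᶠ T : ℕ in atTop,
      Real.exp ((1 - a) * Real.log T) * (expectedPlays H π q T i₁ / T) ≤ 1 := by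
    have h := (hπ.expectedPlays_isLittleO hq.1 (gap_pos_of_mem_cellCompl hq)
      ha).tendsto_div_nhds_zero
    filter_upwards [h.eventually_le_const one_pos, hpos] with T hT hT1
    have hT0 : (0 : ℝ) < T := by linarith
    refine le_trans (le_of_eq ?_) hT
    rw [mul_comm (1 - a), ← Real.rpow_def_of_pos hT0, Real.rpow_sub hT0, Real.rpow_one]
    field_simp
  -- Under `p` the other actions are suboptimal, hence `i₁` is played in almost all rounds.
  have hpplays : Tendsto (fun T : ℕ => expectedPlays H π p T i₁ / T) atTop (nhds 1) := by
    have h : ∀ i : {i : Fin N // i ≠ i₁},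
        Tendsto (fun T : ℕ => expectedPlays H π p T i / T) atTop (nhds 0) := fun i => by
      simpa using (hπ.expectedPlays_isLittleO hp (hgap i i.2) one_pos).tendsto_div_nhds_zero
    have h1 : Tendsto (fun T : ℕ => 1 - ∑ i : {i : Fin N // i ≠ i₁}, expectedPlays H π p T i / T)
        atTop (nhds 1) := by
      simpa using (tendsto_finsetSum Finset.univ fun i _ => h i).const_sub 1
    refine h1.congr' ?_
    filter_upwards [hpos] with T hT
    have hT0 : (T : ℝ) ≠ 0 := by linarith
    have hsum := sum_expectedPlays H π hp T
    rw [Fintype.sum_eq_add_sum_subtype_ne _ i₁] at hsum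
    rw [← Finset.sum_div, eq_div_iff hT0, sub_mul, div_mul_cancel₀ _ hT0]
    linarith
  have hineq : ∀ᶠ T : ℕ in l, (1 - a) * (expectedPlays H π p T i₁ / T) ≤
      Real.log 2 / Real.log T + ∑ i : {i : Fin N // i ≠ i₁},
        expectedPlays H π p T i / Real.log T *
          realKL (signalMatrix H i *ᵥ p) (signalMatrix H i *ᵥ q) := by
    filter_upwards [hl hqplays, hl hpos] with T hT hT1
    have hlogT : 0 < Real.log T := Real.log_pos hT1
    have h := mul_expectedPlays_le H π hp hq.1 hac i₁ (Nat.cast_pos.mp (zero_lt_one.trans hT1)) hT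
    rw [Fintype.sum_eq_add_sum_subtype_ne _ i₁, ← hfib, realKL_self, mul_zero, zero_add] at h
    have hdiv : Real.log 2 / Real.log T + ∑ i : {i : Fin N // i ≠ i₁},
        expectedPlays H π p T i / Real.log T *
          realKL (signalMatrix H i *ᵥ p) (signalMatrix H i *ᵥ q) =
        (Real.log 2 + ∑ i : {i : Fin N // i ≠ i₁}, expectedPlays H π p T i *
          realKL (signalMatrix H i *ᵥ p) (signalMatrix H i *ᵥ q)) / Real.log T := by
      rw [add_div, Finset.sum_div]
      congr 1
      exact Finset.sum_congr rfl fun i _ => by ring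
    rw [hdiv, le_div_iff₀ hlogT]
    linarith
  have hlim : 1 - a ≤ 0 + ∑ i, r i * realKL (signalMatrix H i *ᵥ p) (signalMatrix H i *ᵥ q) := by
    refine le_of_tendsto_of_tendsto ?_ ?_ hineq
    · simpa using (hpplays.mono_left hl).const_mul (1 - a)
    · exact ((hlog.const_div_atTop _).mono_left hl).add
        (tendsto_finsetSum _ fun i _ => (hr i).mul_const _)
  linarith

lemma continuous_signalMatrix_mulVec (H : Matrix (Fin N) (Fin M) (Fin A)) (i : Fin N) (k : Fin A) :
    Continuous fun q => (signalMatrix H i *ᵥ q) k :=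
  (continuous_apply k).comp (continuous_const.matrix_mulVec continuous_id)

/-- The divergence is continuous in its second argument where it is finite. -/
lemma continuousAt_realKL_signal (H : Matrix (Fin N) (Fin M) (Fin A)) (i : Fin N) {x : Fin A → ℝ}
    {q : Fin M → ℝ} (hac : ∀ k, (signalMatrix H i *ᵥ q) k = 0 → x k = 0) :
    ContinuousAt (fun q => realKL x (signalMatrix H i *ᵥ q)) q := by
  refine tendsto_finsetSum _ fun k _ => ?_
  by_cases hx : x k = 0
  · simp [hx]
  · have hy := mt (hac k) hx
    have hc := (continuous_signalMatrix_mulVec H i k).continuousAt (x := q)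
    exact ((continuousAt_const.div₀ hc hy).log (div_ne_zero hx hy)).const_mul _

lemma sum_mul_klDivergence_eq_top {ι : Type*} [Fintype ι] {r : ι → ℝ} (hr : ∀ i, 0 < r i)
    {x y : ι → Fin A → ℝ} (hac : ¬ ∀ i k, y i k = 0 → x i k = 0) :
    ∑ i, ENNReal.ofReal (r i) * klDivergence (x i) (y i) = ∞ := by
  obtain ⟨i, hi⟩ := not_forall.mp hac
  refine ENNReal.sum_eq_top.mpr ⟨i, Finset.mem_univ i, ?_⟩
  rw [klDivergence_of_not_ac hi]
  exact ENNReal.mul_top (ENNReal.ofReal_pos.mpr (hr i)).ne'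

lemma ofReal_le_sum_mul_klDivergence {ι : Type*} [Fintype ι] {r : ι → ℝ}
    (hr : ∀ i, 0 ≤ r i) {x y : ι → Fin A → ℝ} (hac : ∀ i k, y i k = 0 → x i k = 0) {c : ℝ}
    (h : c ≤ ∑ i, r i * realKL (x i) (y i)) :
    ENNReal.ofReal c ≤ ∑ i, ENNReal.ofReal (r i) * klDivergence (x i) (y i) := by
  calc ENNReal.ofReal c ≤ ENNReal.ofReal (∑ i, r i * realKL (x i) (y i)) :=
        ENNReal.ofReal_le_ofReal h
    _ ≤ ∑ i, ENNReal.ofReal (r i * realKL (x i) (y i)) :=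
        Finset.le_sum_of_subadditive _ ENNReal.ofReal_zero.le (fun _ _ => ENNReal.ofReal_add_le) _ _
    _ = _ := Finset.sum_congr rfl fun i _ => by
        rw [ENNReal.ofReal_mul (hr i), klDivergence_of_ac (hac i)]

/-- A limit point `r` of the numbers of plays divided by `log T` becomes admissible when all its
entries are increased. -/
lemma add_mem_admissible {L : Matrix (Fin N) (Fin M) ℝ} {H : Matrix (Fin N) (Fin M) (Fin A)}
    {π : Algorithm N A} (hπ : StronglyConsistent L H π) {p : Fin M → ℝ}
    (hp : p ∈ stdSimplex ℝ (Fin M)) {i₁ : Fin N} (hgap : ∀ i, i ≠ i₁ → 0 < gap L p i)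
    (hreg : closure (cellCompl L i₁) ∩ signalFiber H i₁ (signalMatrix H i₁ *ᵥ p) ⊆
      closure (cellCompl L i₁ ∩ signalFiber H i₁ (signalMatrix H i₁ *ᵥ p)))
    {l : Filter ℕ} [NeBot l] (hl : l ≤ atTop) {r : {i : Fin N // i ≠ i₁} → ℝ}
    (hr0 : ∀ i, 0 ≤ r i)
    (hr : ∀ i : {i : Fin N // i ≠ i₁},
      Tendsto (fun T : ℕ => expectedPlays H π p T i / Real.log T) l (nhds (r i)))
    {ε : ℝ} (hε : 0 < ε) :
    (fun i => r i + ε) ∈ admissible L H i₁ fun i => signalMatrix H i *ᵥ p := by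
  refine ⟨fun i => add_nonneg (hr0 i) hε.le, le_iInf₂ fun q hq => ?_⟩
  by_cases hac : ∀ (i : {i : Fin N // i ≠ i₁}) k,
      (signalMatrix H i *ᵥ q) k = 0 → (signalMatrix H i *ᵥ p) k = 0
  · -- Absolute continuity is also needed for `i₁`, where the two signal distributions coincide.
    have hac' : ∀ i k, (signalMatrix H i *ᵥ q) k = 0 → (signalMatrix H i *ᵥ p) k = 0 := by
      intro i k
      by_cases hi : i = i₁
      · have hfib : signalMatrix H i₁ *ᵥ p = signalMatrix H i₁ *ᵥ q := hq.2
        rw [hi, hfib]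
        exact id
      · exact hac ⟨i, hi⟩ k
    have hne : NeBot (nhdsWithin q (cellCompl L i₁ ∩
        signalFiber H i₁ (signalMatrix H i₁ *ᵥ p))) :=
      mem_closure_iff_nhdsWithin_neBot.mp (hreg hq)
    have hacNear : ∀ᶠ q' in nhds q, ∀ i k,
        (signalMatrix H i *ᵥ q') k = 0 → (signalMatrix H i *ᵥ p) k = 0 := by
      refine eventually_all.mpr fun i => eventually_all.mpr fun k => ?_
      by_cases hx : (signalMatrix H i *ᵥ p) k = 0
      · exact Eventually.of_forall fun _ _ => hx
      · filter_upwards [(continuous_signalMatrix_mulVec H i k).continuousAt.eventually_ne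
          (mt (hac' i k) hx)] with q' hq' h0
        exact absurd h0 hq'
    have hone : 1 ≤ ∑ i, r i * realKL (signalMatrix H i *ᵥ p) (signalMatrix H i *ᵥ q) := by
      have hlim : Tendsto (fun q' => ∑ i : {i : Fin N // i ≠ i₁},
          r i * realKL (signalMatrix H i *ᵥ p) (signalMatrix H i *ᵥ q')) (nhds q)
          (nhds (∑ i : {i : Fin N // i ≠ i₁},
            r i * realKL (signalMatrix H i *ᵥ p) (signalMatrix H i *ᵥ q))) :=
        tendsto_finsetSum _ fun (i : {i : Fin N // i ≠ i₁}) _ =>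
          (continuousAt_realKL_signal H i (hac i)).tendsto.const_mul (r i)
      refine ge_of_tendsto (hlim.mono_left (nhdsWithin_le_nhds
        (s := cellCompl L i₁ ∩ signalFiber H i₁ (signalMatrix H i₁ *ᵥ p)))) ?_
      filter_upwards [nhdsWithin_le_nhds hacNear, self_mem_nhdsWithin] with q' hq' hmem
      exact one_le_sum_mul_realKL hπ hp hgap hl hr hmem.1 hmem.2 hq'
    have h := ofReal_le_sum_mul_klDivergence hr0 hac hone
    rw [ENNReal.ofReal_one] at h
    refine h.trans (Finset.sum_le_sum fun i _ => mul_le_mul_left ?_ _)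
    exact ENNReal.ofReal_le_ofReal (le_add_of_nonneg_right hε.le)
  · exact le_top.trans_eq (sum_mul_klDivergence_eq_top
      (fun i => add_pos_of_nonneg_of_pos (hr0 i) hε) hac).symm

/-! ### Feasibility of the program -/

/-- The divergence dominates the squared Hellinger distance, which unlike the divergence is
continuous. -/
lemma sum_sq_sqrt_sub_sqrt_le_realKL {x y : Fin A → ℝ} (hx : x ∈ stdSimplex ℝ (Fin A))
    (hy : y ∈ stdSimplex ℝ (Fin A)) (hac : ∀ k, y k = 0 → x k = 0) :
    ∑ k, (√(x k) - √(y k)) ^ 2 ≤ realKL x y := by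
  have hterm : ∀ k, (√(x k) - √(y k)) ^ 2 ≤ x k * Real.log (x k / y k) + y k - x k := by
    intro k
    rw [sub_sq, Real.sq_sqrt (hx.1 k), Real.sq_sqrt (hy.1 k)]
    rcases (hx.1 k).eq_or_lt with h0 | hxk
    · simp [← h0]
    have hyk : 0 < y k := (hy.1 k).lt_of_ne fun h => hxk.ne' (hac k h.symm)
    have hsx := Real.sqrt_pos.mpr hxk
    have hsy := Real.sqrt_pos.mpr hyk
    -- `log (x / y) = -2 log √(y / x) ≥ 2 (1 - √(y / x))`
    have hlog : 2 * (1 - √(y k) / √(x k)) ≤ Real.log (x k / y k) := by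
      have h := Real.log_le_sub_one_of_pos (div_pos hsy hsx)
      rw [Real.log_div hsy.ne' hsx.ne', Real.log_sqrt hyk.le, Real.log_sqrt hxk.le] at h
      rw [Real.log_div hxk.ne' hyk.ne']
      linarith
    have hmul := mul_le_mul_of_nonneg_left hlog hxk.le
    have heq : x k * (2 * (1 - √(y k) / √(x k))) = 2 * x k - 2 * √(x k) * √(y k) := by
      have : x k * (√(y k) / √(x k)) = √(x k) * √(y k) := by
        rw [mul_div_assoc', div_eq_iff hsx.ne']
        nlinarith [Real.mul_self_sqrt hxk.le]
      linarith
    linarith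
  calc _ ≤ ∑ k, (x k * Real.log (x k / y k) + y k - x k) :=
        Finset.sum_le_sum fun k _ => hterm k
    _ = realKL x y := by
        rw [Finset.sum_sub_distrib, Finset.sum_add_distrib, hx.2, hy.2, realKL]
        ring

/-- Under global observability the signal distributions determine the loss differences. -/
lemma GloballyObservable.sub_dotProduct_eq {L : Matrix (Fin N) (Fin M) ℝ}
    {H : Matrix (Fin N) (Fin M) (Fin A)} (hobs : GloballyObservable L H) {p q : Fin M → ℝ}
    (h : ∀ k, signalMatrix H k *ᵥ p = signalMatrix H k *ᵥ q) (i j : Fin N) :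
    (L i - L j) ⬝ᵥ p = (L i - L j) ⬝ᵥ q := by
  let f : (Fin M → ℝ) →ₗ[ℝ] ℝ :=
    { toFun := fun v => v ⬝ᵥ (p - q)
      map_add' := fun v w => add_dotProduct v w _
      map_smul' := fun c v => smul_dotProduct c v _ }
  have hle : ⨆ k, LinearMap.range (signalMatrix H k)ᵀ.mulVecLin ≤ LinearMap.ker f := by
    refine iSup_le fun k => ?_
    rintro _ ⟨x, rfl⟩
    change ((signalMatrix H k)ᵀ *ᵥ x) ⬝ᵥ (p - q) = 0
    rw [Matrix.mulVec_transpose, ← Matrix.dotProduct_mulVec, Matrix.mulVec_sub, h k, sub_self,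
      dotProduct_zero]
  have h0 : (L i - L j) ⬝ᵥ (p - q) = 0 := hle (hobs i j)
  rwa [dotProduct_sub, sub_eq_zero] at h0

/-- The strategies under which `i₁` is the unique optimal action form an open set that misses
`cellCompl L i₁`. -/
lemma notMem_closure_cellCompl {L : Matrix (Fin N) (Fin M) ℝ} {i₁ : Fin N} {q : Fin M → ℝ}
    (hq : ∀ i, i ≠ i₁ → 0 < (L i - L i₁) ⬝ᵥ q) : q ∉ closure (cellCompl L i₁) := by
  have hopen : IsOpen {q : Fin M → ℝ | ∀ i, i ≠ i₁ → 0 < (L i - L i₁) ⬝ᵥ q} := by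
    simp only [Set.ofPred_forall]
    exact isOpen_iInter_of_finite fun i => isOpen_iInter_of_finite fun _ =>
      isOpen_lt continuous_const (continuous_const.dotProduct continuous_id)
  intro hmem
  obtain ⟨q', hq', hcompl⟩ := mem_closure_iff.mp hmem _ hopen hq
  refine hcompl.2 ⟨hcompl.1, fun j hj => ?_⟩
  have := hq' j hj
  rw [sub_dotProduct] at this ⊢
  linarith

lemma closure_cellCompl_subset (L : Matrix (Fin N) (Fin M) ℝ) (i : Fin N) :
    closure (cellCompl L i) ⊆ stdSimplex ℝ (Fin M) :=
  closure_minimal Set.sdiff_subset (isClosed_stdSimplex ℝ (Fin M))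

/-- By compactness the alternatives are uniformly separated from `p` in Hellinger distance, so that
a large constant vector is admissible. -/
lemma admissible_nonempty {L : Matrix (Fin N) (Fin M) ℝ} {H : Matrix (Fin N) (Fin M) (Fin A)}
    (hobs : GloballyObservable L H) {p : Fin M → ℝ} (hp : p ∈ stdSimplex ℝ (Fin M)) {i₁ : Fin N}
    (hopt : ∀ i, i ≠ i₁ → L i₁ ⬝ᵥ p < L i ⬝ᵥ p) :
    (admissible L H i₁ fun i => signalMatrix H i *ᵥ p).Nonempty := by
  set K := closure (cellCompl L i₁) ∩ signalFiber H i₁ (signalMatrix H i₁ *ᵥ p) with hK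
  have hKsub : K ⊆ stdSimplex ℝ (Fin M) :=
    Set.inter_subset_left.trans (closure_cellCompl_subset L i₁)
  have hclosed : IsClosed (signalFiber H i₁ (signalMatrix H i₁ *ᵥ p)) :=
    isClosed_eq continuous_const (continuous_const.matrix_mulVec continuous_id)
  have hcompact : IsCompact K :=
    (isCompact_stdSimplex ℝ (Fin M)).of_isClosed_subset (isClosed_closure.inter hclosed) hKsub
  let h : (Fin M → ℝ) → ℝ := fun q => ∑ i : {i : Fin N // i ≠ i₁},
    ∑ k, (√((signalMatrix H i *ᵥ p) k) - √((signalMatrix H i *ᵥ q) k)) ^ 2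
  have hcont : Continuous h := continuous_finsetSum _ fun i _ => continuous_finsetSum _ fun k _ =>
    (continuous_const.sub (continuous_signalMatrix_mulVec H i k).sqrt).pow 2
  have hpos : ∀ q ∈ K, 0 < h q := by
    intro q hq
    have hnn : ∀ i : {i : Fin N // i ≠ i₁},
        0 ≤ ∑ k, (√((signalMatrix H i *ᵥ p) k) - √((signalMatrix H i *ᵥ q) k)) ^ 2 :=
      fun i => Finset.sum_nonneg fun k _ => sq_nonneg _
    refine (Finset.sum_nonneg fun i _ => hnn i).lt_of_ne fun h0 => ?_
    have hsig : ∀ i, signalMatrix H i *ᵥ p = signalMatrix H i *ᵥ q := by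
      intro i
      by_cases hi : i = i₁
      · rw [hi]
        exact hq.2
      · ext k
        have hi0 := (Finset.sum_eq_zero_iff_of_nonneg fun i _ => hnn i).mp h0.symm ⟨i, hi⟩
          (Finset.mem_univ _)
        have hk0 := (Finset.sum_eq_zero_iff_of_nonneg fun k _ => sq_nonneg _).mp hi0 k
          (Finset.mem_univ _)
        have hs := sub_eq_zero.mp (pow_eq_zero_iff two_ne_zero |>.mp hk0)
        exact (Real.sqrt_inj ((signalMatrix_mulVec_mem H i hp).1 k)
          ((signalMatrix_mulVec_mem H i (hKsub hq)).1 k)).mp hs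
    refine notMem_closure_cellCompl (fun i hi => ?_) hq.1
    rw [← hobs.sub_dotProduct_eq hsig, sub_dotProduct, sub_pos]
    exact hopt i hi
  obtain ⟨m, hm, hmK⟩ := hcompact.exists_forall_le' hcont.continuousOn hpos
  refine ⟨fun _ => m⁻¹, fun _ => (inv_pos.mpr hm).le, le_iInf₂ fun q hq => ?_⟩
  by_cases hac : ∀ (i : {i : Fin N // i ≠ i₁}) k,
      (signalMatrix H i *ᵥ q) k = 0 → (signalMatrix H i *ᵥ p) k = 0
  · rw [← ENNReal.ofReal_one]
    refine ofReal_le_sum_mul_klDivergence (fun _ => (inv_pos.mpr hm).le) hac ?_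
    rw [← Finset.mul_sum, inv_mul_eq_div, one_le_div hm]
    exact (hmK q hq).trans (Finset.sum_le_sum fun i _ => sum_sq_sqrt_sub_sqrt_le_realKL
      (signalMatrix_mulVec_mem H i hp) (signalMatrix_mulVec_mem H i (hKsub hq)) (hac i))
  · exact le_top.trans_eq (sum_mul_klDivergence_eq_top (fun _ => inv_pos.mpr hm) hac).symm

/-! ### The regret lower bound -/

lemma lsipValue_le {L : Matrix (Fin N) (Fin M) ℝ} {H : Matrix (Fin N) (Fin M) (Fin A)}
    {p : Fin M → ℝ} {i₁ : Fin N} (hopt : ∀ i, i ≠ i₁ → L i₁ ⬝ᵥ p < L i ⬝ᵥ p)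
    {P : Fin N → Fin A → ℝ} {r : {i : Fin N // i ≠ i₁} → ℝ} (hr : r ∈ admissible L H i₁ P) :
    lsipValue L H i₁ p P ≤ ∑ i : {i : Fin N // i ≠ i₁}, r i * ((L i - L i₁) ⬝ᵥ p) := by
  refine csInf_le ⟨0, ?_⟩ ⟨r, hr, rfl⟩
  rintro _ ⟨r', hr', rfl⟩
  refine Finset.sum_nonneg fun i _ => mul_nonneg (hr'.1 i) ?_
  rw [sub_dotProduct]
  exact (sub_pos.mpr (hopt i i.2)).le

/-- If the bound failed by `δ * log T` infinitely often, the numbers of plays divided by `log T`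
would be bounded along these `T`, and a limit point would yield admissible vectors of too small a
value. -/
lemma eventually_lsipValue_mul_log_le {L : Matrix (Fin N) (Fin M) ℝ}
    {H : Matrix (Fin N) (Fin M) (Fin A)} {π : Algorithm N A} (hπ : StronglyConsistent L H π)
    {p : Fin M → ℝ} (hp : p ∈ stdSimplex ℝ (Fin M)) {i₁ : Fin N}
    (hopt : ∀ i, i ≠ i₁ → L i₁ ⬝ᵥ p < L i ⬝ᵥ p)
    (hreg : closure (cellCompl L i₁) ∩ signalFiber H i₁ (signalMatrix H i₁ *ᵥ p) ⊆
      closure (cellCompl L i₁ ∩ signalFiber H i₁ (signalMatrix H i₁ *ᵥ p)))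
    {δ : ℝ} (hδ : 0 < δ) :
    ∀ᶠ T : ℕ in atTop, lsipValue L H i₁ p (fun i => signalMatrix H i *ᵥ p) * Real.log T -
      expectedRegret L H π p T ≤ δ * Real.log T := by
  set C := lsipValue L H i₁ p (fun i => signalMatrix H i *ᵥ p) with hC
  by_contra hfail
  rw [not_eventually] at hfail
  have hgap : ∀ i, i ≠ i₁ → 0 < gap L p i := fun i hi => by
    rw [gap_eq_of_isOptimal hopt, sub_dotProduct]
    exact sub_pos.mpr (hopt i hi)
  have hne : NeBot (atTop ⊓ 𝓟 {T : ℕ | ¬ (C * Real.log T - expectedRegret L H π p T ≤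
      δ * Real.log T)}) := frequently_mem_iff_neBot.mp hfail
  let l := Ultrafilter.of (atTop ⊓ 𝓟 {T : ℕ | ¬ (C * Real.log T - expectedRegret L H π p T ≤
      δ * Real.log T)})
  have hl : (l : Filter ℕ) ≤ atTop := (Ultrafilter.of_le _).trans inf_le_left
  have hlog : ∀ᶠ T : ℕ in (l : Filter ℕ), 0 < Real.log T := hl <|
    (Real.tendsto_log_atTop.comp tendsto_natCast_atTop_atTop).eventually_gt_atTop 0
  -- The plays per `log T`; along an ultrafilter of failing `T` they stay in a box, hence converge.
  let ρ : ℕ → {i : Fin N // i ≠ i₁} → ℝ := fun T i => expectedPlays H π p T i / Real.log T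
  have hregret : ∀ T : ℕ, ∑ i, ρ T i * gap L p i = expectedRegret L H π p T / Real.log T := by
    intro T
    rw [expectedRegret_eq_sum L H π hp, Fintype.sum_eq_add_sum_subtype_ne _ i₁,
      gap_eq_of_isOptimal hopt i₁, sub_self, zero_dotProduct, mul_zero, zero_add, Finset.sum_div]
    exact Finset.sum_congr rfl fun i _ => by ring
  have hsmall : ∀ᶠ T : ℕ in (l : Filter ℕ), ∑ i, ρ T i * gap L p i ≤ C - δ := by
    filter_upwards [hlog, (Ultrafilter.of_le _).trans inf_le_right (mem_principal_self _)]
      with T hT hmem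
    rw [hregret, div_le_iff₀ hT]
    have : δ * Real.log T < C * Real.log T - expectedRegret L H π p T := not_le.mp hmem
    linarith
  have hρ0 : ∀ᶠ T : ℕ in (l : Filter ℕ), ∀ i, 0 ≤ ρ T i := by
    filter_upwards [hlog] with T hT i
    exact div_nonneg (expectedPlays_nonneg H π hp T i) hT.le
  have hbox : ∀ᶠ T : ℕ in (l : Filter ℕ),
      ρ T ∈ Set.Icc (0 : {i : Fin N // i ≠ i₁} → ℝ) fun i => (C - δ) / gap L p i := by
    filter_upwards [hρ0, hsmall] with T hT hle
    refine ⟨hT, fun i => ?_⟩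
    rw [le_div_iff₀ (hgap i i.2)]
    exact (Finset.single_le_sum (f := fun i : {i : Fin N // i ≠ i₁} => ρ T i * gap L p i)
      (fun j _ => mul_nonneg (hT j) (gap_nonneg L p j)) (Finset.mem_univ i)).trans hle
  obtain ⟨r, hr, hlim⟩ := isCompact_Icc.ultrafilter_le_nhds' (l.map ρ) hbox
  have hlim' : ∀ i : {i : Fin N // i ≠ i₁},
      Tendsto (fun T : ℕ => expectedPlays H π p T i / Real.log T) (l : Filter ℕ) (nhds (r i)) := fun i =>
    (tendsto_pi_nhds.mp (show Tendsto ρ (l : Filter ℕ) (nhds r) from hlim)) i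
  have hrC : ∑ i, r i * gap L p i ≤ C - δ :=
    le_of_tendsto (tendsto_finsetSum _ fun i _ => (hlim' i).mul_const _) hsmall
  have hCr : C ≤ ∑ i, r i * gap L p i := by
    have hle : ∀ᶠ ε : ℝ in nhdsWithin 0 (Set.Ioi 0), C ≤ ∑ i, (r i + ε) * gap L p i := by
      filter_upwards [self_mem_nhdsWithin] with ε hε
      have := lsipValue_le hopt (add_mem_admissible hπ hp hgap hreg hl (fun i => hr.1 i) hlim' hε)
      simpa only [gap_eq_of_isOptimal hopt] using this
    have hcont : Tendsto (fun ε : ℝ => ∑ i, (r i + ε) * gap L p i) (nhds 0)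
        (nhds (∑ i, (r i + 0) * gap L p i)) :=
      (continuous_finsetSum _ fun i _ =>
        (continuous_const.add continuous_id).mul continuous_const).tendsto 0
    simp only [add_zero] at hcont
    exact ge_of_tendsto (hcont.mono_left nhdsWithin_le_nhds) hle
  linarith

end PartialMonitoring

theorem theorem2 {N M A : ℕ} (L : Matrix (Fin N) (Fin M) ℝ) (H : Matrix (Fin N) (Fin M) (Fin A))
    (hobs : PartialMonitoring.GloballyObservable L H)
    (p : Fin M → ℝ) (hp : p ∈ stdSimplex ℝ (Fin M))
    (i₁ : Fin N) (hopt : ∀ i, i ≠ i₁ → L i₁ ⬝ᵥ p < L i ⬝ᵥ p)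
    (hreg : closure (PartialMonitoring.cellCompl L i₁) ∩
        PartialMonitoring.signalFiber H i₁ (PartialMonitoring.signalMatrix H i₁ *ᵥ p) ⊆
      closure (PartialMonitoring.cellCompl L i₁ ∩
        PartialMonitoring.signalFiber H i₁ (PartialMonitoring.signalMatrix H i₁ *ᵥ p)))
    (π : PartialMonitoring.Algorithm N A)
    (hπ : PartialMonitoring.StronglyConsistent L H π) :
    (PartialMonitoring.admissible L H i₁
        (fun i => PartialMonitoring.signalMatrix H i *ᵥ p)).Nonempty ∧
    ∃ g : ℕ → ℝ, g =o[atTop] (fun T : ℕ => Real.log T) ∧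
      ∀ T : ℕ,
        PartialMonitoring.lsipValue L H i₁ p
            (fun i => PartialMonitoring.signalMatrix H i *ᵥ p) * Real.log T - g T ≤
          PartialMonitoring.expectedRegret L H π p T := by
  refine ⟨PartialMonitoring.admissible_nonempty hobs hp hopt, fun T => max 0
    (PartialMonitoring.lsipValue L H i₁ p
      (fun i => PartialMonitoring.signalMatrix H i *ᵥ p) * Real.log T -
        PartialMonitoring.expectedRegret L H π p T), ?_, fun T => ?_⟩
  · refine isLittleO_iff.mpr fun δ hδ => ?_
    filter_upwards [PartialMonitoring.eventually_lsipValue_mul_log_le hπ hp hopt hreg hδ] with T hT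
    have hlog : 0 ≤ Real.log T := Real.log_natCast_nonneg T
    rw [Real.norm_of_nonneg (le_max_left _ _), Real.norm_of_nonneg hlog]
    exact max_le (mul_nonneg hδ.le hlog) hT
  · have := le_max_right 0 (PartialMonitoring.lsipValue L H i₁ p
      (fun i => PartialMonitoring.signalMatrix H i *ᵥ p) * Real.log T -
        PartialMonitoring.expectedRegret L H π p T)
    linarith
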